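/- A continuum is a nondegenerate (i.e. having more than one point) compact connected metric space. Let $X$ be a continuum, and let $C(X)$ be the hyperspace of all nonempty compact connected subsets of $X$ (one-point sets included), endowed with the Hausdorff metric. For $p\in X$ let $C(p,X)=\{A\in C(X): p\in A\}$, and let $HS(p,X)=C(X)/C(p,X)$ be the quotient space, with the quotient topology, obtained from $C(X)$ by identifying all elements of $C(p,X)$ to a single point. A space $Y$ is called unicoherent if, whenever $A$ and $B$ are closed connected nonempty subsets of $Y$ with $Y=A\cup B$, the intersection $A\cap B$ is connected and nonempty. Theorem. For every continuum $X$ and every $p\in X$, the space $HS(p,X)$ is unicoherent. -/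

import Mathlib

open TopologicalSpace

/-- The hyperspace `C(X)` of subcontinua of `X`: all nonempty compact connected subsets of `X`
(singletons included), as a subspace of the nonempty compact subsets of `X` with the Hausdorff
metric. -/
abbrev SubcontinuumHyperspace (X : Type*) [MetricSpace X] : Type _ :=
  {K : NonemptyCompacts X // IsConnected (K : Set X)}

/-- The metric carried by `C(X)` is the Hausdorff metric. -/
theorem SubcontinuumHyperspace.dist_eq {X : Type*} [MetricSpace X]
    (A B : SubcontinuumHyperspace X) :
    dist A B = Metric.hausdorffDist ((A : NonemptyCompacts X) : Set X)
      ((B : NonemptyCompacts X) : Set X) :=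
  rfl

/-- `C(p,X)`: the subcontinua of `X` that contain the point `p`, as a subset of `C(X)`. -/
def subcontinuaThrough {X : Type*} [MetricSpace X] (p : X) : Set (SubcontinuumHyperspace X) :=
  {A | p ∈ (A : NonemptyCompacts X)}

/-- The equivalence relation on `Y` that identifies all points of `S` with each other and
nothing else. -/
def collapseSetoid {Y : Type*} (S : Set Y) : Setoid Y where
  r a b := a = b ∨ (a ∈ S ∧ b ∈ S)
  iseqv :=
    { refl := fun _ => Or.inl rfl
      symm := by
        rintro a b (rfl | ⟨ha, hb⟩)
        · exact Or.inl rfl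
        · exact Or.inr ⟨hb, ha⟩
      trans := by
        rintro a b c (rfl | ⟨ha, hb⟩) (rfl | ⟨hb', hc⟩)
        · exact Or.inl rfl
        · exact Or.inr ⟨hb', hc⟩
        · exact Or.inr ⟨ha, hb⟩
        · exact Or.inr ⟨ha, hc⟩ }

/-- The hyperspace `HS(p,X) = C(X)/C(p,X)`, with the quotient topology. -/
abbrev HS (X : Type*) [MetricSpace X] (p : X) : Type _ :=
  Quotient (collapseSetoid (subcontinuaThrough p))

/-- A space is unicoherent if, whenever it is the union of two closed connected subsets, their
intersection is connected. Connected sets are nonempty here, in the hypotheses and in the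
conclusion. -/
def Unicoherent (Y : Type*) [TopologicalSpace Y] : Prop :=
  ∀ A B : Set Y, IsClosed A → IsConnected A → IsClosed B → IsConnected B →
    A ∪ B = Set.univ → IsConnected (A ∩ B)

open Set Metric Topology Filter

/-! Unicoherence passes to quotients with connected fibres, so it suffices that C(p,X) is connected
and C(X) unicoherent. The latter follows once every map f from C(X) to the unit circle has a
continuous logarithm. C(X) need not be contractible, so a coarse contraction is used: iterated
closed δ-thickening carries every subcontinuum to X in a uniform number N of steps and keeps δ-close
sets within δ. The iterates may be disconnected, but they are δ-chained, and by compactness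
δ-chained sets lie near subcontinua (`exists_approx`). Summing principal logarithms of ratios of f
along the resulting finite chains gives the logarithm; the same chains, kept inside C(p,X), show
that C(p,X) is connected. -/

/-! ### Chained sets -/

/-- A set is `δ`-chained if it has no proper nonempty relative subset that is closed under steps
of length at most `δ`. -/
def IsChained {X : Type*} [PseudoMetricSpace X] (δ : ℝ) (K : Set X) : Prop :=
  ∀ S : Set X, (K ∩ S).Nonempty → (∀ x ∈ K ∩ S, ∀ y ∈ K, dist x y ≤ δ → y ∈ S) → K ⊆ S

namespace IsChained

variable {X : Type*} [PseudoMetricSpace X] {δ δ' η : ℝ} {K L : Set X}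

theorem mono (h : IsChained δ K) (hδ : δ ≤ δ') : IsChained δ' K :=
  fun S hne hS => h S hne fun x hx y hy hxy => hS x hx y hy (hxy.trans hδ)

theorem of_isPreconnected (hδ : 0 < δ) (hK : IsPreconnected K) : IsChained δ K := by
  intro S hne hS x hx
  by_contra hxS
  have hU : IsOpen (⋃ y ∈ K ∩ S, ball y δ) := isOpen_biUnion fun _ _ => isOpen_ball
  have hV : IsOpen (⋃ y ∈ K \ S, ball y δ) := isOpen_biUnion fun _ _ => isOpen_ball
  obtain ⟨a, ha⟩ := hne
  obtain ⟨z, hzK, hzU, hzV⟩ := hK _ _ hU hV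
    (fun y hy => by
      by_cases hyS : y ∈ S
      · exact Or.inl (mem_biUnion ⟨hy, hyS⟩ (mem_ball_self hδ))
      · exact Or.inr (mem_biUnion ⟨hy, hyS⟩ (mem_ball_self hδ)))
    ⟨a, ha.1, mem_biUnion ha (mem_ball_self hδ)⟩
    ⟨x, hx, mem_biUnion ⟨hx, hxS⟩ (mem_ball_self hδ)⟩
  simp only [mem_iUnion, mem_ball, exists_prop] at hzU hzV
  obtain ⟨b, hb, hzb⟩ := hzU
  obtain ⟨c, hc, hzc⟩ := hzV
  have hzS := hS b hb z hzK (by rw [dist_comm]; exact hzb.le)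
  exact hc.2 (hS z ⟨hzK, hzS⟩ c hc.1 hzc.le)

theorem isPreconnected (hK : IsCompact K) (hKc : IsClosed K) (h : ∀ δ > 0, IsChained δ K) :
    IsPreconnected K := by
  rw [isPreconnected_iff_subset_of_fully_disjoint_closed hKc]
  intro u v hu hv huv hd
  rcases (K ∩ u).eq_empty_or_nonempty with he | hne
  · right
    intro x hx
    exact (huv hx).resolve_left fun hxu => he.subset ⟨hx, hxu⟩
  · left
    obtain ⟨δ, hδ, hth⟩ := (hd.mono_left inter_subset_right).exists_thickenings
      (hK.inter_right hu) hv
    refine h (δ / 2) (by positivity) u hne fun x hx y hy hxy => (huv hy).resolve_right fun hyv => ?_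
    refine disjoint_left.1 hth (mem_thickening_iff.2 ⟨x, hx, ?_⟩) (self_subset_thickening hδ v hyv)
    rw [dist_comm]
    linarith

/-- A step of length δ in `L` is shadowed by a step of length at most δ + 2η in `K`. -/
theorem of_close (hL : IsChained δ L) (hKL : ∀ x ∈ K, ∃ y ∈ L, dist x y ≤ η)
    (hLK : ∀ y ∈ L, ∃ x ∈ K, dist x y ≤ η) (hδ : 0 ≤ δ) : IsChained (δ + 2 * η) K := by
  intro S ⟨a, haK, haS⟩ hS
  have key : L ⊆ {y | ∃ x ∈ K ∩ S, dist x y ≤ η} := by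
    refine hL _ ?_ ?_
    · obtain ⟨b, hb, hab⟩ := hKL a haK
      exact ⟨b, hb, a, ⟨haK, haS⟩, hab⟩
    · rintro y ⟨hy, x, hx, hxy⟩ y' hy' hyy'
      obtain ⟨x', hx', hxy'⟩ := hLK y' hy'
      refine ⟨x', ⟨hx', hS x hx x' hx' ?_⟩, hxy'⟩
      have := dist_triangle4_right x x' y y'
      linarith
  intro x hx
  obtain ⟨y, hy, hxy⟩ := hKL x hx
  obtain ⟨x₀, hx₀, hx₀y⟩ := key hy
  refine hS x₀ hx₀ x hx ?_
  have := dist_triangle_right x₀ x y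
  linarith

end IsChained

/-! ### Closed thickenings as nonempty compact sets -/

section Thicken

variable {X : Type*} [MetricSpace X]

theorem TopologicalSpace.NonemptyCompacts.exists_dist_lt {K L : NonemptyCompacts X} {r : ℝ}
    (h : dist K L < r) {x : X} (hx : x ∈ K) : ∃ y ∈ L, dist x y < r :=
  exists_dist_lt_of_hausdorffDist_lt hx h
    (hausdorffEDist_ne_top_of_nonempty_of_bounded K.nonempty L.nonempty K.isCompact.isBounded
      L.isCompact.isBounded)

theorem IsChained.isConnected_of_approx {K : NonemptyCompacts X}
    (h : ∀ δ > 0, ∃ L : NonemptyCompacts X, IsChained δ (L : Set X) ∧ dist K L < δ) :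
    IsConnected (K : Set X) := by
  refine ⟨K.nonempty, IsChained.isPreconnected K.isCompact K.isCompact.isClosed fun δ hδ => ?_⟩
  obtain ⟨L, hL, hd⟩ := h (δ / 3) (by positivity)
  refine (hL.of_close (K := (K : Set X)) (η := δ / 3) (fun x hx => ?_) (fun y hy => ?_)
    (by positivity)).mono (by ring_nf; rfl)
  · obtain ⟨y, hy, hxy⟩ := NonemptyCompacts.exists_dist_lt hd hx
    exact ⟨y, hy, hxy.le⟩
  · rw [dist_comm] at hd
    obtain ⟨x, hx, hxy⟩ := NonemptyCompacts.exists_dist_lt hd hy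
    exact ⟨x, hx, by rw [dist_comm]; exact hxy.le⟩

variable [CompactSpace X]

/-- The closed `δ`-thickening of a nonempty compact set in a compact space. -/
noncomputable def thicken (δ : ℝ) (K : NonemptyCompacts X) : NonemptyCompacts X where
  carrier := cthickening δ (K : Set X)
  isCompact' := isClosed_cthickening.isCompact
  nonempty' := K.nonempty.mono (self_subset_cthickening _)

variable {δ : ℝ} {K L : NonemptyCompacts X}

theorem mem_thicken (hδ : 0 ≤ δ) {x : X} : x ∈ thicken δ K ↔ ∃ y ∈ K, dist x y ≤ δ := by
  change x ∈ cthickening δ (K : Set X) ↔ _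
  rw [K.isCompact.cthickening_eq_biUnion_closedBall hδ]
  simp

theorem le_thicken : K ≤ thicken δ K := self_subset_cthickening (K : Set X)

theorem thicken_mono (δ : ℝ) : Monotone (thicken (X := X) δ) :=
  fun _ _ h => cthickening_subset_of_subset δ h

theorem dist_le_of_le_thicken (hδ : 0 ≤ δ) (hKL : K ≤ thicken δ L) (hLK : L ≤ thicken δ K) :
    dist K L ≤ δ :=
  hausdorffDist_le_of_mem_dist hδ (fun _ hx => (mem_thicken hδ).1 (hKL hx))
    (fun _ hx => (mem_thicken hδ).1 (hLK hx))

theorem le_thicken_of_dist_lt (h : dist K L < δ) : K ≤ thicken δ L := fun x hx => by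
  obtain ⟨y, hy, hxy⟩ := NonemptyCompacts.exists_dist_lt h hx
  exact (mem_thicken (dist_nonneg.trans h.le)).2 ⟨y, hy, hxy.le⟩

theorem dist_thicken_le (hδ : 0 ≤ δ) : dist K (thicken δ K) ≤ δ :=
  dist_le_of_le_thicken hδ (le_thicken.trans le_thicken) le_rfl

theorem IsChained.thicken (hδ : 0 ≤ δ) (hK : IsChained δ (K : Set X)) :
    IsChained δ (thicken δ K : Set X) := by
  intro S ⟨a, haK, haS⟩ hS
  obtain ⟨b, hb, hab⟩ := (mem_thicken hδ).1 haK
  have key : (K : Set X) ⊆ S :=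
    hK S ⟨b, hb, hS a ⟨haK, haS⟩ b (le_thicken hb) hab⟩
      fun x hx y hy => hS x ⟨le_thicken hx.1, hx.2⟩ y (le_thicken hy)
  intro x hx
  obtain ⟨y, hy, hxy⟩ := (mem_thicken hδ).1 hx
  exact hS y ⟨le_thicken hy, key hy⟩ x hx (by rwa [dist_comm])

theorem IsChained.iterate_thicken (hδ : 0 ≤ δ) (hK : IsChained δ (K : Set X)) (n : ℕ) :
    IsChained δ ((_root_.thicken δ)^[n] K : Set X) := by
  induction n with
  | zero => exact hK
  | succ n ih =>
    rw [Function.iterate_succ_apply']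
    exact ih.thicken hδ

theorem iterate_thicken_le_of_le (n : ℕ) (h : K ≤ thicken δ L) :
    (thicken δ)^[n] K ≤ thicken δ ((thicken δ)^[n] L) := by
  rw [← Function.iterate_succ_apply' (thicken δ), Function.iterate_succ_apply]
  exact (thicken_mono δ).iterate n h

/-- Thickening is monotone and commutes with its own iterates, so the mutual inclusions that express
δ-closeness survive every iteration with no loss. -/
theorem dist_iterate_thicken_le (hδ : 0 ≤ δ) (h : dist K L < δ) (n : ℕ) :
    dist ((thicken δ)^[n] K) ((thicken δ)^[n] L) ≤ δ :=
  dist_le_of_le_thicken hδ (iterate_thicken_le_of_le n (le_thicken_of_dist_lt h))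
    (iterate_thicken_le_of_le n (le_thicken_of_dist_lt (by rwa [dist_comm])))

theorem iterate_thicken_monotone (δ : ℝ) (K : NonemptyCompacts X) :
    Monotone fun n => (thicken δ)^[n] K :=
  monotone_nat_of_le_succ fun n => by
    rw [Function.iterate_succ_apply']
    exact le_thicken

variable [ConnectedSpace X]

/-- Iterating a closed thickening exhausts a compact connected space uniformly. -/
theorem exists_iterate_thicken_eq_top (hδ : 0 < δ) :
    ∃ n, ∀ K : NonemptyCompacts X, (thicken δ)^[n] K = ⊤ := by
  have reach : ∀ x y : X, ∃ n, y ∈ (thicken δ)^[n] {x} := by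
    intro x y
    refine IsChained.of_isPreconnected hδ (isPreconnected_univ (α := X))
      {y | ∃ n, y ∈ (thicken δ)^[n] {x}} ⟨x, mem_univ _, 0, ?_⟩ ?_ (mem_univ y)
    · exact mem_singleton x
    · rintro a ⟨-, n, ha⟩ b - hab
      refine ⟨n + 1, ?_⟩
      rw [Function.iterate_succ_apply']
      exact (mem_thicken hδ.le).2 ⟨a, ha, by rwa [dist_comm]⟩
  have key : ∀ x : X, ∃ n, ∀ y : X, y ∈ (thicken δ)^[n] {x} := by
    intro x
    suffices ∃ n, ∀ y ∈ (univ : Set X), y ∈ (thicken δ)^[n] {x} by simpa using this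
    refine isCompact_univ.induction_on (p := fun s => ∃ n, ∀ y ∈ s, y ∈ (thicken δ)^[n] {x})
      ⟨0, by simp⟩ (fun s t hst ⟨n, hn⟩ => ⟨n, fun y hy => hn y (hst hy)⟩) ?_ ?_
    · rintro s t ⟨n, hn⟩ ⟨m, hm⟩
      refine ⟨max n m, ?_⟩
      rintro y (hy | hy)
      · exact iterate_thicken_monotone δ _ (le_max_left n m) (hn y hy)
      · exact iterate_thicken_monotone δ _ (le_max_right n m) (hm y hy)
    · intro y _
      obtain ⟨n, hn⟩ := reach x y
      refine ⟨closedBall y δ, mem_nhdsWithin_of_mem_nhds (closedBall_mem_nhds y hδ), n + 1, ?_⟩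
      intro z hz
      rw [Function.iterate_succ_apply']
      exact (mem_thicken hδ.le).2 ⟨y, hn, hz⟩
  have unif : ∃ n, ∀ x ∈ (univ : Set X), ∀ y : X, y ∈ (thicken δ)^[n] {x} := by
    refine isCompact_univ.induction_on
      (p := fun s => ∃ n, ∀ x ∈ s, ∀ y : X, y ∈ (thicken δ)^[n] {x})
      ⟨0, by simp⟩ (fun s t hst ⟨n, hn⟩ => ⟨n, fun x hx => hn x (hst hx)⟩) ?_ ?_
    · rintro s t ⟨n, hn⟩ ⟨m, hm⟩
      refine ⟨max n m, ?_⟩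
      rintro x (hx | hx) y
      · exact iterate_thicken_monotone δ _ (le_max_left n m) (hn x hx y)
      · exact iterate_thicken_monotone δ _ (le_max_right n m) (hm x hx y)
    · intro x _
      obtain ⟨n, hn⟩ := key x
      -- For z in this ball, `{x}` lies in the thickening of `{z}`; one extra iterate therefore
      -- serves the whole ball.
      refine ⟨closedBall x δ, mem_nhdsWithin_of_mem_nhds (closedBall_mem_nhds x hδ), n + 1, ?_⟩
      intro z hz y
      rw [Function.iterate_succ_apply]
      refine (thicken_mono δ).iterate n (?_ : ({x} : NonemptyCompacts X) ≤ thicken δ {z}) (hn y)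
      rintro w (rfl : w = x)
      exact (mem_thicken hδ.le).2 ⟨z, mem_singleton z, by rw [dist_comm]; exact hz⟩
  obtain ⟨n, hn⟩ := unif
  refine ⟨n, fun K => top_le_iff.1 fun y _ => ?_⟩
  obtain ⟨x, hx⟩ := K.nonempty
  refine (thicken_mono δ).iterate n (?_ : ({x} : NonemptyCompacts X) ≤ K) (hn x (mem_univ x) y)
  rintro w (rfl : w = x)
  exact hx

end Thicken

/-! ### Approximation of chained sets by subcontinua -/

namespace SubcontinuumHyperspace

variable {X : Type*} [MetricSpace X]

theorem isClosed_setOf_isConnected :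
    IsClosed {K : NonemptyCompacts X | IsConnected (K : Set X)} := by
  refine isClosed_of_closure_subset fun K hK => IsChained.isConnected_of_approx fun δ hδ => ?_
  obtain ⟨L, hL, hd⟩ := Metric.mem_closure_iff.1 hK δ hδ
  exact ⟨L, .of_isPreconnected hδ hL.isPreconnected, hd⟩

theorem isClosed_setOf_mem (p : X) : IsClosed {K : NonemptyCompacts X | p ∈ K} := by
  have : {K : NonemptyCompacts X | p ∈ K} =
      {K : NonemptyCompacts X | infDist p (K : Set X) = 0} := by
    ext K
    exact K.isCompact.isClosed.mem_iff_infDist_zero K.nonempty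
  rw [this]
  exact isClosed_eq (lipschitz_infDist_set p).continuous continuous_const

theorem isClosed_subcontinuaThrough (p : X) : IsClosed (subcontinuaThrough p) :=
  (isClosed_setOf_mem p).preimage continuous_subtype_val

variable [CompactSpace X]

instance instCompactSpace : CompactSpace (SubcontinuumHyperspace X) :=
  isCompact_iff_compactSpace.1 (isClosed_setOf_isConnected (X := X)).isCompact

/-- Sets that are `δ`-chained for small `δ` are close to subcontinua. -/
theorem exists_approx {Z : Set (NonemptyCompacts X)} (hZ : IsClosed Z) {ε : ℝ} (hε : 0 < ε) :
    ∃ δ > 0, δ ≤ ε ∧ ∀ K ∈ Z, IsChained δ (K : Set X) →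
      ∃ C : SubcontinuumHyperspace X, C.1 ∈ Z ∧ dist C.1 K < ε := by
  -- Otherwise there are ε/(n+1)-chained counterexamples in `Z`. A subsequential limit is connected
  -- and lies in `Z`, hence approximates late terms of the subsequence.
  by_contra! H
  have hpos : ∀ n : ℕ, (0 : ℝ) < ε / (n + 1) := fun n => by positivity
  choose K hKZ hKc hK using fun n : ℕ => H (ε / (n + 1)) (hpos n)
    (div_le_self hε.le (by linarith [n.cast_nonneg (α := ℝ)]))
  obtain ⟨L, -, φ, hφ, hL⟩ := isCompact_univ.tendsto_subseq (x := K) fun n => mem_univ _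
  have hLZ : L ∈ Z := hZ.mem_of_tendsto hL (Eventually.of_forall fun n => hKZ _)
  have hlim : Tendsto (fun n : ℕ => ε / ((φ n : ℝ) + 1)) atTop (𝓝 0) :=
    (tendsto_const_div_atTop_nhds_zero_nat ε |>.comp
      ((tendsto_add_atTop_nat 1).comp hφ.tendsto_atTop)).congr fun n => by simp
  have hd : ∀ η > 0, ∀ᶠ n in atTop, dist L (K (φ n)) < η := fun η hη =>
    (hL.eventually (ball_mem_nhds L hη)).mono fun n hn => by rw [dist_comm]; exact hn
  have hLc : IsConnected (L : Set X) := IsChained.isConnected_of_approx fun η hη => by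
    obtain ⟨n, hn, hn'⟩ := ((hd η hη).and (hlim.eventually (gt_mem_nhds hη))).exists
    exact ⟨K (φ n), (hKc _).mono hn'.le, hn⟩
  obtain ⟨n, hn⟩ := (hd ε hε).exists
  exact (hK (φ n) ⟨L, hLc⟩ hLZ).not_gt hn

/-- A choice of subcontinua close to the sets that are `δ`-chained, fixing the subcontinua. -/
theorem exists_approx_map {Z : Set (NonemptyCompacts X)} (hZ : IsClosed Z) {ε : ℝ} (hε : 0 < ε) :
    ∃ δ > 0, δ ≤ ε ∧ ∃ c : NonemptyCompacts X → SubcontinuumHyperspace X,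
      (∀ A : SubcontinuumHyperspace X, c A.1 = A) ∧
      ∀ K ∈ Z, IsChained δ (K : Set X) → (c K).1 ∈ Z ∧ dist (c K).1 K < ε := by
  classical
  obtain ⟨δ, hδ, hδε, h⟩ := exists_approx hZ hε
  have : ∀ K : NonemptyCompacts X, ∃ C : SubcontinuumHyperspace X,
      (∀ hK : IsConnected (K : Set X), C = ⟨K, hK⟩) ∧
      (K ∈ Z → IsChained δ (K : Set X) → C.1 ∈ Z ∧ dist C.1 K < ε) := by
    intro K
    by_cases hK : IsConnected (K : Set X)
    · exact ⟨⟨K, hK⟩, fun _ => rfl, fun hKZ _ => ⟨hKZ, by simpa using hε⟩⟩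
    by_cases hK' : K ∈ Z ∧ IsChained δ (K : Set X)
    · obtain ⟨C, hC⟩ := h K hK'.1 hK'.2
      exact ⟨C, fun h => absurd h hK, fun _ _ => hC⟩
    · obtain ⟨x, -⟩ := K.nonempty
      exact ⟨⟨{x}, isConnected_singleton⟩, fun h => absurd h hK, fun h1 h2 => absurd ⟨h1, h2⟩ hK'⟩
  choose c hc hc' using this
  exact ⟨δ, hδ, hδε, c, fun A => hc A.1 A.2, hc'⟩

/-- The whole space as a point of its hyperspace of subcontinua. -/
def whole (X : Type*) [MetricSpace X] [CompactSpace X] [ConnectedSpace X] :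
    SubcontinuumHyperspace X :=
  ⟨⊤, isConnected_univ⟩

variable [ConnectedSpace X]

theorem whole_mem_subcontinuaThrough (p : X) : whole X ∈ subcontinuaThrough p := mem_univ p

/-- Thickening preserves membership of `p`, and the approximants are chosen within the closed set of
compacta containing `p`. They link each `A` to X by steps of at most ε/3 + δ + ε/3 ≤ ε. -/
theorem isConnected_subcontinuaThrough (p : X) : IsConnected (subcontinuaThrough p) := by
  refine ⟨⟨_, whole_mem_subcontinuaThrough p⟩,
    IsChained.isPreconnected (isClosed_subcontinuaThrough p).isCompact
      (isClosed_subcontinuaThrough p) fun ε hε T => ?_⟩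
  obtain ⟨δ, hδ, hδε, c, hc, hc'⟩ := exists_approx_map (isClosed_setOf_mem p)
    (show 0 < ε / 3 by positivity)
  obtain ⟨N, hN⟩ := exists_iterate_thicken_eq_top (X := X) hδ
  rintro ⟨A, hA, hAT⟩ hT
  have step : ∀ A ∈ subcontinuaThrough p, (A ∈ T ↔ whole X ∈ T) := by
    intro A hA
    have hmem : ∀ n, p ∈ (thicken δ)^[n] A.1 := fun n =>
      iterate_thicken_monotone δ A.1 n.zero_le hA
    have happ : ∀ n, p ∈ (c ((thicken δ)^[n] A.1)).1 ∧
        dist (c ((thicken δ)^[n] A.1)).1 ((thicken δ)^[n] A.1) < ε / 3 := fun n =>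
      hc' _ (hmem n) ((IsChained.of_isPreconnected hδ A.2.isPreconnected).iterate_thicken hδ.le n)
    have hd : ∀ n, dist (c ((thicken δ)^[n] A.1)) (c ((thicken δ)^[n + 1] A.1)) ≤ ε := by
      intro n
      have h1 := (happ n).2
      have h2 := (happ (n + 1)).2
      have h3 : dist ((thicken δ)^[n] A.1) ((thicken δ)^[n + 1] A.1) ≤ δ := by
        rw [Function.iterate_succ_apply']
        exact dist_thicken_le hδ.le
      have h4 := dist_triangle4 (c ((thicken δ)^[n] A.1)).1 ((thicken δ)^[n] A.1)
        ((thicken δ)^[n + 1] A.1) (c ((thicken δ)^[n + 1] A.1)).1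
      rw [dist_comm] at h2
      rw [Subtype.dist_eq]
      linarith
    have hiff : ∀ n, A ∈ T ↔ c ((thicken δ)^[n] A.1) ∈ T := by
      intro n
      induction n with
      | zero => rw [Function.iterate_zero_apply, hc]
      | succ n ih =>
        rw [ih]
        exact ⟨fun h => hT _ ⟨(happ n).1, h⟩ _ (happ (n + 1)).1 (hd n),
          fun h => hT _ ⟨(happ (n + 1)).1, h⟩ _ (happ n).1 (by rw [dist_comm]; exact hd n)⟩
    rw [hiff N, hN, ← hc (whole X)]
    rfl
  exact fun B hB => (step B hB).2 ((step A hA).1 hAT)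

instance instConnectedSpace : ConnectedSpace (SubcontinuumHyperspace X) := by
  have hX : Nonempty X := inferInstance
  have hu : (⋃ p : X, subcontinuaThrough p) = univ :=
    eq_univ_of_forall fun A => by
      obtain ⟨x, hx⟩ := A.1.nonempty
      exact mem_iUnion.2 ⟨x, hx⟩
  rw [connectedSpace_iff_univ, ← hu]
  exact ⟨⟨whole X, mem_iUnion.2 ⟨hX.some, whole_mem_subcontinuaThrough _⟩⟩,
    isPreconnected_iUnion ⟨whole X, mem_iInter.2 whole_mem_subcontinuaThrough⟩
      fun p => (isConnected_subcontinuaThrough p).isPreconnected⟩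

end SubcontinuumHyperspace

/-! ### Continuous logarithms -/

theorem Complex.re_div_pos_of_dist_lt_one {x y : ℂ} (hy : ‖y‖ = 1) (h : dist x y < 1) :
    0 < (x / y).re := by
  have hy0 : y ≠ 0 := norm_ne_zero_iff.1 (by rw [hy]; exact one_ne_zero)
  have h1 : ‖x / y - 1‖ < 1 := by
    rw [div_sub_one hy0, norm_div, hy, div_one, ← dist_eq_norm]
    exact h
  have h2 := (abs_le.1 (Complex.abs_re_le_norm (x / y - 1))).1
  rw [Complex.sub_re, Complex.one_re] at h2
  linarith

/-- The principal logarithm of the ratio is additive on close points of the unit circle. -/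
theorem Complex.log_div_add_log_div {x y z : ℂ} (hy : ‖y‖ = 1) (hz : ‖z‖ = 1)
    (hxy : dist x y < 1) (hyz : dist y z < 1) :
    log (x / y) + log (y / z) = log (x / z) := by
  have h1 := re_div_pos_of_dist_lt_one hy hxy
  have h2 := re_div_pos_of_dist_lt_one hz hyz
  have hy0 : y ≠ 0 := norm_ne_zero_iff.1 (by rw [hy]; exact one_ne_zero)
  have a1 := abs_lt.1 (abs_arg_lt_pi_div_two_iff.2 (Or.inl h1))
  have a2 := abs_lt.1 (abs_arg_lt_pi_div_two_iff.2 (Or.inl h2))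
  rw [← log_mul (fun h => by simp [h] at h1) (fun h => by simp [h] at h2)
    ⟨by linarith, by linarith⟩, div_mul_div_cancel₀ hy0]

/-- Every map from the hyperspace of subcontinua to the unit circle has a continuous logarithm. -/
theorem SubcontinuumHyperspace.exists_continuous_log {X : Type*} [MetricSpace X] [CompactSpace X]
    [ConnectedSpace X] {f : SubcontinuumHyperspace X → ℂ} (hf : Continuous f)
    (hf1 : ∀ A, ‖f A‖ = 1) :
    ∃ φ : SubcontinuumHyperspace X → ℂ, Continuous φ ∧ ∀ A, Complex.exp (φ A) = f A := by
  obtain ⟨ε, hε, hfε⟩ := Metric.uniformContinuous_iff.1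
    (CompactSpace.uniformContinuous_of_continuous hf) 1 one_pos
  obtain ⟨δ, hδ, hδε, c, hc, hc'⟩ := exists_approx_map (X := X) isClosed_univ
    (show 0 < ε / 4 by positivity)
  obtain ⟨N, hN⟩ := exists_iterate_thicken_eq_top (X := X) hδ
  have hf0 : ∀ A, f A ≠ 0 := fun A => norm_ne_zero_iff.1 (by rw [hf1]; exact one_ne_zero)
  set T : ℕ → SubcontinuumHyperspace X → NonemptyCompacts X :=
    fun n A => (thicken δ)^[n] A.1 with hT
  set g : ℕ → SubcontinuumHyperspace X → ℂ := fun n A => f (c (T n A)) with hg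
  have hT0 : ∀ A, T 0 A = A.1 := fun A => rfl
  have hg0 : ∀ A, g 0 A = f A := fun A => by simp only [hg, hT0, hc]
  have hgN : ∀ A B, g N A = g N B := fun A B => by simp only [hg, hT, hN]
  -- Two approximation errors below ε/4 and 2δ ≤ ε/2 total less than ε.
  have hclose : ∀ n A m B, dist (T n A) (T m B) ≤ 2 * δ → dist (g n A) (g m B) < 1 := by
    intro n A m B h
    have happ : ∀ n A, dist (c (T n A)).1 (T n A) < ε / 4 := fun n A =>
      (hc' _ (mem_univ _)
        ((IsChained.of_isPreconnected hδ A.2.isPreconnected).iterate_thicken hδ.le n)).2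
    refine hfε ?_
    have h1 := happ n A
    have h2 := happ m B
    rw [dist_comm] at h2
    have h3 := dist_triangle4 (c (T n A)).1 (T n A) (T m B) (c (T m B)).1
    rw [Subtype.dist_eq]
    linarith
  have hsucc : ∀ n A, dist (T n A) (T (n + 1) A) ≤ δ := fun n A => by
    simp only [hT, Function.iterate_succ_apply']
    exact dist_thicken_le hδ.le
  -- Ladder between the chains of `A` and `B`: in each square both routes from `g n A` to `g (n + 1)
  -- B` have the same logarithm sum, that of the diagonal.
  have htel : ∀ A B, dist A B < δ → ∀ n,
      ∑ k ∈ Finset.range n, Complex.log (g k A / g (k + 1) A) + Complex.log (g n A / g n B) =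
        Complex.log (f A / f B) + ∑ k ∈ Finset.range n, Complex.log (g k B / g (k + 1) B) := by
    intro A B hAB n
    have hAB' : ∀ n, dist (T n A) (T n B) ≤ δ := dist_iterate_thicken_le hδ.le hAB
    induction n with
    | zero => simp [hg0]
    | succ n ih =>
      have e1 := Complex.log_div_add_log_div (hf1 (c (T (n + 1) A))) (hf1 (c (T (n + 1) B)))
        (hclose n A (n + 1) A (by linarith [hsucc n A]))
        (hclose (n + 1) A (n + 1) B (by linarith [hAB' (n + 1)]))
      have e2 := Complex.log_div_add_log_div (hf1 (c (T n B))) (hf1 (c (T (n + 1) B)))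
        (hclose n A n B (by linarith [hAB' n]))
        (hclose n B (n + 1) B (by linarith [hsucc n B]))
      rw [Finset.sum_range_succ, Finset.sum_range_succ]
      linear_combination ih + e1 - e2
  have hexp : ∀ A n, Complex.exp (∑ k ∈ Finset.range n, Complex.log (g k A / g (k + 1) A)) =
      f A / g n A := by
    intro A n
    induction n with
    | zero => simp [hg0, hf0]
    | succ n ih =>
      rw [Finset.sum_range_succ, Complex.exp_add, ih,
        Complex.exp_log (div_ne_zero (hf0 _) (hf0 _)), div_mul_div_cancel₀ (hf0 _)]
  refine ⟨fun A => Complex.log (g N A) +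
    ∑ k ∈ Finset.range N, Complex.log (g k A / g (k + 1) A), ?_, fun A => ?_⟩
  -- The choice `c`, hence each `g k`, may be discontinuous. But `g N` is constant, so `htel` makes
  -- the candidate near `B` a constant plus `log (f A / f B)`.
  · rw [continuous_iff_continuousAt]
    intro B
    have hlog : ContinuousAt (fun A => Complex.log (f A / f B)) B := by
      refine (hf.continuousAt.div_const _).clog ?_
      rw [div_self (hf0 B)]
      exact Complex.one_mem_slitPlane
    refine (hlog.add (continuousAt_const (y := Complex.log (g N B) +
      ∑ k ∈ Finset.range N, Complex.log (g k B / g (k + 1) B)))).congr ?_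
    filter_upwards [ball_mem_nhds B hδ] with A hA
    have h := htel A B hA N
    rw [hgN A B, div_self (hf0 _), Complex.log_one, add_zero] at h
    rw [h, hgN A B, Pi.add_apply]
    ring
  · rw [Complex.exp_add, Complex.exp_log (hf0 _), hexp, mul_div_cancel₀ _ (hf0 _)]

/-- Two continuous logarithms of one function differ by a constant on a preconnected set. -/
theorem IsPreconnected.eq_of_exp_eq_one {Y : Type*} [TopologicalSpace Y] {S : Set Y}
    (hS : IsPreconnected S) {φ : Y → ℂ} (hφ : ContinuousOn φ S)
    (h : ∀ y ∈ S, Complex.exp (φ y) = 1) {x y : Y} (hx : x ∈ S) (hy : y ∈ S) : φ x = φ y := by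
  have hd : IsDiscrete (range ((↑) : ℤ → ℂ)) :=
    (Complex.isometry_ofReal.isEmbedding.comp
      Int.isClosedEmbedding_coe_real.isEmbedding).isInducing.isDiscrete_range
  have hπ := Complex.two_pi_I_ne_zero
  have := hS.constant_of_mapsTo hd (hφ.div_const (2 * Real.pi * Complex.I)) (fun z hz => by
    obtain ⟨n, hn⟩ := Complex.exp_eq_one_iff.1 (h z hz)
    exact ⟨n, by simp only [hn, mul_div_cancel_right₀ _ hπ]⟩) hx hy
  exact (div_left_inj' hπ).1 this

/-- A connected normal space is unicoherent if all its maps to the unit circle have continuous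
logarithms. -/
theorem Unicoherent.of_exists_continuous_log {Y : Type*} [TopologicalSpace Y] [NormalSpace Y]
    [ConnectedSpace Y]
    (hlog : ∀ f : Y → ℂ, Continuous f → (∀ y, ‖f y‖ = 1) →
      ∃ φ : Y → ℂ, Continuous φ ∧ ∀ y, Complex.exp (φ y) = f y) : Unicoherent Y := by
  classical
  intro A B hA hAc hB hBc hAB
  refine ⟨?_, ?_⟩
  · simpa using isPreconnected_closed_iff.1 (isPreconnected_univ (α := Y)) A B hA hB hAB.ge
      (by simpa using hAc.nonempty) (by simpa using hBc.nonempty)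
  rw [isPreconnected_iff_subset_of_fully_disjoint_closed (hA.inter hB)]
  intro u v hu hv huv hd
  by_contra! hne
  obtain ⟨⟨b, hbAB, hbu⟩, ⟨a, haAB, hav⟩⟩ := hne.imp not_subset.1 not_subset.1
  have hau := (huv haAB).resolve_right hav
  have hbv := (huv hbAB).resolve_left hbu
  obtain ⟨w, hw0, hw1, -⟩ := exists_continuous_zero_one_of_isClosed hu hv hd
  set ψ : Y → ℂ := fun y => Real.pi * w y * Complex.I with hψ
  have hψc : Continuous ψ := by fun_prop
  have hψu : ∀ y ∈ u, ψ y = 0 := fun y hy => by simp [hψ, hw0 hy]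
  have hψv : ∀ y ∈ v, ψ y = Real.pi * Complex.I := fun y hy => by simp [hψ, hw1 hy]
  have hψAB : ∀ y ∈ A ∩ B, Complex.exp (ψ y) = Complex.exp (-ψ y) := by
    intro y hy
    rcases huv hy with h | h
    · rw [hψu y h, neg_zero]
    · rw [hψv y h, Complex.exp_neg, Complex.exp_pi_mul_I]
      norm_num
  -- The two formulas agree on A ∩ B, where w is 0 or 1. For a logarithm φ of `f`, φ - ψ is constant
  -- on A and φ + ψ on B; comparing `a` with `b` forces 2πi = 0.
  set f : Y → ℂ := fun y => if y ∈ A then Complex.exp (ψ y) else Complex.exp (-ψ y) with hf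
  have hfA : EqOn f (fun y => Complex.exp (ψ y)) A := fun y hy => if_pos hy
  have hfB : EqOn f (fun y => Complex.exp (-ψ y)) B := fun y hy => by
    by_cases hyA : y ∈ A
    · rw [hfA hyA]
      exact hψAB y ⟨hyA, hy⟩
    · exact if_neg hyA
  have hfc : Continuous f := by
    rw [← continuousOn_univ, ← hAB]
    exact ((by fun_prop : Continuous fun y => Complex.exp (ψ y)).continuousOn.congr
      hfA).union_of_isClosed
      ((by fun_prop : Continuous fun y => Complex.exp (-ψ y)).continuousOn.congr hfB) hA hB
  have hf1 : ∀ y, ‖f y‖ = 1 := by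
    intro y
    simp only [hf]
    split_ifs <;> simp [Complex.norm_exp, hψ]
  obtain ⟨φ, hφc, hφ⟩ := hlog f hfc hf1
  have eA := hAc.isPreconnected.eq_of_exp_eq_one (hφc.sub hψc).continuousOn
    (fun y hy => by
      simp only [Pi.sub_apply]
      rw [Complex.exp_sub, hφ, hfA hy, div_self (Complex.exp_ne_zero _)]) haAB.1 hbAB.1
  have eB := hBc.isPreconnected.eq_of_exp_eq_one (hφc.add hψc).continuousOn
    (fun y hy => by
      simp only [Pi.add_apply]
      rw [Complex.exp_add, hφ, hfB hy, ← Complex.exp_add, neg_add_cancel, Complex.exp_zero])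
    haAB.2 hbAB.2
  simp only [Pi.sub_apply, Pi.add_apply, hψu a hau, hψv b hbv] at eA eB
  refine Complex.two_pi_I_ne_zero ?_
  linear_combination eA - eB

/-! ### Monotone quotients -/

theorem Unicoherent.of_isQuotientMap {Y Z : Type*} [TopologicalSpace Y] [TopologicalSpace Z]
    (hY : Unicoherent Y) {q : Y → Z} (hq : IsQuotientMap q)
    (hfib : ∀ z, IsConnected (q ⁻¹' {z})) : Unicoherent Z := by
  intro A B hA hAc hB hBc hAB
  have h := hY _ _ (hA.preimage hq.continuous)
    (hq.isCoinducing.isConnected_preimage_of_isClosed hfib hA hAc) (hB.preimage hq.continuous)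
    (hq.isCoinducing.isConnected_preimage_of_isClosed hfib hB hBc)
    (by rw [← preimage_union, hAB, preimage_univ])
  rw [← preimage_inter] at h
  rw [← image_preimage_eq (A ∩ B) hq.surjective]
  exact h.image q hq.continuous.continuousOn

theorem isConnected_preimage_mk_collapseSetoid {Y : Type*} [TopologicalSpace Y] {S : Set Y}
    (hS : IsConnected S) (z : Quotient (collapseSetoid S)) :
    IsConnected ((Quotient.mk (collapseSetoid S)) ⁻¹' {z}) := by
  induction z using Quotient.inductionOn with | h y =>
  by_cases hy : y ∈ S
  · convert hS
    ext a
    refine Quotient.eq.trans ⟨?_, fun ha => Or.inr ⟨ha, hy⟩⟩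
    rintro (rfl | h)
    exacts [hy, h.1]
  · convert isConnected_singleton (x := y)
    ext a
    exact Quotient.eq.trans ⟨fun h => h.resolve_right fun h => hy h.2, Or.inl⟩

theorem mainTheorem8 {X : Type*} [MetricSpace X] [CompactSpace X] [ConnectedSpace X]
    [Nontrivial X] (p : X) : Unicoherent (HS X p) :=
  (Unicoherent.of_exists_continuous_log fun _ hf hf1 =>
    SubcontinuumHyperspace.exists_continuous_log hf hf1).of_isQuotientMap isQuotientMap_quotient_mk'
    (isConnected_preimage_mk_collapseSetoid
      (SubcontinuumHyperspace.isConnected_subcontinuaThrough p))
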